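/- Let $\mathcal X$ be a nonempty set, $G$ a finite abelian group with character group $\hat G$, $\mathcal A$ a finite subgroup of the group of all functions $\mathcal X\to G$ (with pointwise addition), and $f$ a homomorphism from $\mathcal A$ to some group. Put $\mathcal B=\ker f$ and $\mathcal C=\mathcal A/\mathcal B$, and let $q\ge 0$ be an integer. For $\mathbf x\in\mathcal X^q$ and $\boldsymbol\xi\in\hat G^q$ let $e_{\mathbf x,\boldsymbol\xi}$ be the character $A\mapsto\prod_{i=1}^q\xi_i(A(x_i))$ of $\mathcal A$. Let $E_{\mathcal A,q}$ be the set of all functions $e_{\mathbf x,\boldsymbol\xi}$ on $\mathcal A$ and, for $e\in E_{\mathcal A,q}$, let $E_{\mathcal A,q,f,e}$ be the set of those $e'\in E_{\mathcal A,q}$ that agree with $e$ on $\mathcal B$. A $q$-query (sequential) quantum algorithm has a workspace with an orthonormal basis $\mathcal Z$. It starts from a unit vector of the Hilbert space with orthonormal basis $|x,\xi,z\rangle$ ($x\in\mathcal X$, $\xi\in\hat G$, $z\in\mathcal Z$) and makes $q$ queries $|x,\xi,z\rangle\mapsto\xi(A(x))\,|x,\xi,z\rangle$ to its oracle $A$.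 After each query it applies a unitary that does not depend on $A$. Finally it measures in this basis and outputs a function of the outcome. A parallel $q$-query algorithm works instead on the space with orthonormal basis $|x_1,\xi_1,\dots,x_q,\xi_q,z\rangle$, makes its $q$ queries at once by $|\mathbf x,\boldsymbol\xi,z\rangle\mapsto\prod_{i}\xi_i(A(x_i))\,|\mathbf x,\boldsymbol\xi,z\rangle$, then applies one unitary that does not depend on $A$, and measures and outputs as before. The success probability is the probability that the output is $f(A)$, where $A$ is uniformly random in $\mathcal A$. Then the maximum success probability of a $q$-query quantum algorithm is exactly $$P_{\mathcal A,q,f}=\frac1{|\mathcal C|}\max_{e\in E_{\mathcal A,q}}|E_{\mathcal A,q,f,e}|=\frac{|\mathcal B|}{|\mathcal A|}\max_{e\in E_{\mathcal A,q}}|E_{\mathcal A,q,f,e}| .$$ That is, no $q$-query sequential algorithm, with any workspace, has a larger success probability. Moreover, some $q$-query sequential algorithm and some parallel $q$-query algorithm, both with finite workspaces, have success probability exactly $P_{\mathcal A,q,f}$. The same holds if queries are made in the controlled-add model, in which $\hat G$ is replaced by $G$ in the description of the registers and a query is $|x,g,z\rangle\mapsto|x,g+A(x),z\rangle$ (in the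 parallel case, $|x_1,g_1,\dots,x_q,g_q,z\rangle\mapsto|x_1,g_1+A(x_1),\dots,x_q,g_q+A(x_q),z\rangle$). -/

import Mathlib

noncomputable section

namespace GroupQOC

open scoped ENNReal

/-- The Hilbert space with orthonormal basis `|i⟩`, `i : ι`. A vector `ψ` is the family of its
amplitudes `ψ i`. For finite `ι` this is `ℂ^ι` with its Euclidean norm. -/
abbrev Ket (ι : Type*) : Type _ := lp (fun _ : ι => ℂ) 2

lemma mem_monomial {ι : Type*} (σ : ι ≃ ι) (c : ι → ℂ) (hc : ∀ i, ‖c i‖ = 1) (ψ : Ket ι) :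
    Memℓp (fun j => c (σ.symm j) * ψ (σ.symm j)) 2 := by
  refine memℓp_gen ?_
  have h := (lp.memℓp ψ).summable (by norm_num)
  have h2 := (σ.symm.summable_iff).2 h
  simpa [Function.comp_def, norm_mul, hc] using h2

/-- The linear map `|i⟩ ↦ c i |σ i⟩`, in terms of amplitudes. -/
def monomialMap {ι : Type*} (σ : ι ≃ ι) (c : ι → ℂ) (hc : ∀ i, ‖c i‖ = 1) : Ket ι →ₗ[ℂ] Ket ι where
  toFun ψ := ⟨fun j => c (σ.symm j) * ψ (σ.symm j), mem_monomial σ c hc ψ⟩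
  map_add' ψ φ := by
    ext j
    exact mul_add _ _ _
  map_smul' a ψ := by
    ext j
    exact mul_left_comm _ _ _

lemma norm_monomialMap {ι : Type*} (σ : ι ≃ ι) (c : ι → ℂ) (hc : ∀ i, ‖c i‖ = 1) (ψ : Ket ι) :
    ‖monomialMap σ c hc ψ‖ = ‖ψ‖ := by
  rw [lp.norm_eq_tsum_rpow (by norm_num), lp.norm_eq_tsum_rpow (by norm_num)]
  congr 1
  rw [← σ.symm.tsum_eq (fun i => ‖ψ i‖ ^ (2 : ℝ≥0∞).toReal)]
  refine tsum_congr fun j => ?_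
  change ‖c (σ.symm j) * ψ (σ.symm j)‖ ^ _ = _
  rw [norm_mul, hc, one_mul]

/-- The unitary operator `|i⟩ ↦ c i |σ i⟩`, for a permutation `σ` of the basis and phases `c i` of
modulus one. -/
def monomial {ι : Type*} (σ : ι ≃ ι) (c : ι → ℂ) (hc : ∀ i, ‖c i‖ = 1) : Ket ι ≃ₗᵢ[ℂ] Ket ι :=
  LinearIsometryEquiv.ofSurjective ⟨monomialMap σ c hc, norm_monomialMap σ c hc⟩ (by
    intro φ
    refine ⟨monomialMap σ.symm (fun j => (c (σ.symm j))⁻¹) (fun j => by simp [hc]) φ, ?_⟩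
    ext j
    have h0 : c (σ.symm j) ≠ 0 := norm_ne_zero_iff.1 (by rw [hc]; exact one_ne_zero)
    change c (σ.symm j) * ((c (σ.symm (σ.symm.symm (σ.symm j))))⁻¹ * φ (σ.symm.symm (σ.symm j))) = φ j
    simp only [Equiv.symm_symm, Equiv.apply_symm_apply]
    exact mul_inv_cancel_left₀ h0 _)

/-- The two equivalent standard forms of a quantum query to a function with values in a finite
abelian group:
* `phase`: `|x, ξ, z⟩ ↦ ξ(A x) |x, ξ, z⟩`, with a response register indexed by characters;
* `controlledAdd`: `|x, g, z⟩ ↦ |x, g + A x, z⟩`, with a response register indexed by the group. -/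
inductive QueryModel
  | phase
  | controlledAdd

namespace QueryModel

/-- The basis of the response register: characters of `G`, or elements of `G`. -/
abbrev Reg (G : Type*) [AddCommGroup G] : QueryModel → Type _
  | phase => AddChar G ℂ
  | controlledAdd => G

/-- How the value `a` of the oracle permutes the basis of the response register. -/
def shift {G : Type*} [AddCommGroup G] : (M : QueryModel) → G → (M.Reg G ≃ M.Reg G)
  | phase, _ => Equiv.refl _
  | controlledAdd, a => Equiv.addRight a

/-- The phase that the value `a` of the oracle puts on a basis state of the response register. -/
def coeff {G : Type*} [AddCommGroup G] : (M : QueryModel) → G → M.Reg G → ℂ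
  | phase, a, ξ => (show AddChar G ℂ from ξ) a
  | controlledAdd, _, _ => 1

lemma norm_coeff {G : Type*} [AddCommGroup G] [Finite G] (M : QueryModel) (a : G) (r : M.Reg G) :
    ‖M.coeff a r‖ = 1 := by
  cases M
  · exact AddChar.norm_apply (show AddChar G ℂ from r) a
  · exact norm_one

end QueryModel

/-- A single query to `A`, on the space with basis `|x, r, z⟩` (query register, response register,
workspace `Z` untouched by the query). -/
def query {X G : Type*} [AddCommGroup G] [Finite G] (M : QueryModel) (Z : Type*) (A : X → G) :
    Ket (X × M.Reg G × Z) ≃ₗᵢ[ℂ] Ket (X × M.Reg G × Z) :=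
  monomial
    { toFun := fun b => (b.1, M.shift (A b.1) b.2.1, b.2.2)
      invFun := fun b => (b.1, (M.shift (A b.1)).symm b.2.1, b.2.2)
      left_inv := fun b => by simp
      right_inv := fun b => by simp }
    (fun b => M.coeff (A b.1) b.2.1)
    (fun b => M.norm_coeff _ _)

/-- `q` simultaneous queries to `A`, on the space with basis `|(x₁, r₁), …, (x_q, r_q), z⟩`: the
`q`-fold tensor power of the single query, tensored with the identity of the workspace `Z`. -/
def parallelQuery {X G : Type*} [AddCommGroup G] [Finite G] (M : QueryModel) (q : ℕ) (Z : Type*)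
    (A : X → G) :
    Ket ((Fin q → X × M.Reg G) × Z) ≃ₗᵢ[ℂ] Ket ((Fin q → X × M.Reg G) × Z) :=
  monomial
    { toFun := fun b => (fun i => ((b.1 i).1, M.shift (A (b.1 i).1) (b.1 i).2), b.2)
      invFun := fun b => (fun i => ((b.1 i).1, (M.shift (A (b.1 i).1)).symm (b.1 i).2), b.2)
      left_inv := fun b => by simp
      right_inv := fun b => by simp }
    (fun b => ∏ i, M.coeff (A (b.1 i).1) (b.1 i).2)
    (fun b => by simp [norm_prod, M.norm_coeff])

/-- An oracle algorithm on the Hilbert space `Ket ι` that calls its oracle `t` times and outputs an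
element of `K`: a unit initial state, arbitrary unitaries (independent of the oracle), the `i`-th of
them applied right after the `i`-th oracle call, and finally a measurement in the basis `ι`, whose
outcome `b` is turned into the output `output b`. A unitary before the first call is absorbed in the
initial state; coins and intermediate measurements are absorbed in the workspace. -/
structure Algorithm (ι K : Type*) (t : ℕ) where
  init : Ket ι
  norm_init : ‖init‖ = 1
  unitary : Fin t → (Ket ι ≃ₗᵢ[ℂ] Ket ι)
  output : ι → K

namespace Algorithm

/-- The state just before the final measurement, when each oracle call applies the operator `O`. -/
def finalState {ι K : Type*} {t : ℕ} (Q : Algorithm ι K t) (O : Ket ι ≃ₗᵢ[ℂ] Ket ι) : Ket ι :=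
  Fin.foldl t (fun ψ i => Q.unitary i (O ψ)) Q.init

/-- The probability that the algorithm outputs `k`: the sum of `|⟨b|ψ⟩|²` over the outcomes `b` of
the measurement that lead to the output `k`. -/
def outputProb {ι K : Type*} {t : ℕ} (Q : Algorithm ι K t) (O : Ket ι ≃ₗᵢ[ℂ] Ket ι) (k : K) : ℝ :=
  ∑' b : {b : ι // Q.output b = k}, ‖Q.finalState O b‖ ^ 2

/-- The probability that the algorithm outputs `f A` for a uniformly random `A` in `𝒜`, when an
oracle call for `A` applies the operator `O A`. -/
def successProb {ι K X G : Type*} {t : ℕ} [AddCommGroup G] [AddGroup K] {𝒜 : AddSubgroup (X → G)}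
    [Fintype 𝒜] (Q : Algorithm ι K t) (O : (X → G) → (Ket ι ≃ₗᵢ[ℂ] Ket ι)) (f : 𝒜 →+ K) : ℝ :=
  (∑ A : 𝒜, Q.outputProb (O A) (f A)) / Fintype.card 𝒜

end Algorithm

/-- The character `e_{x,ξ} : A ↦ ∏ i, ξ i (A (x i))` of `𝒜`. -/
def queryChar {X G : Type*} [AddCommGroup G] (𝒜 : AddSubgroup (X → G)) {q : ℕ}
    (x : Fin q → X) (ξ : Fin q → AddChar G ℂ) : AddChar 𝒜 ℂ where
  toFun A := ∏ i, ξ i ((A : X → G) (x i))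
  map_zero_eq_one' := by simp
  map_add_eq_mul' A B := by simp [AddChar.map_add_eq_mul, Finset.prod_mul_distrib]

/-- `E_{𝒜,q}`: the set of all characters `e_{x,ξ}` of `𝒜`. -/
def queryChars {X G : Type*} [AddCommGroup G] (𝒜 : AddSubgroup (X → G)) (q : ℕ) :
    Set (AddChar 𝒜 ℂ) :=
  {e | ∃ (x : Fin q → X) (ξ : Fin q → AddChar G ℂ), e = queryChar 𝒜 x ξ}

/-- `E_{𝒜,q,f,e}`: the set of those elements of `E_{𝒜,q}` that agree with `e` on `ker f`. -/
def queryClass {X G K : Type*} [AddCommGroup G] [AddGroup K] {𝒜 : AddSubgroup (X → G)}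
    (q : ℕ) (f : 𝒜 →+ K) (e : AddChar 𝒜 ℂ) : Set (AddChar 𝒜 ℂ) :=
  {e' | e' ∈ queryChars 𝒜 q ∧ ∀ B ∈ f.ker, e' B = e B}

end GroupQOC

end

noncomputable section

namespace GroupQOC

open scoped ENNReal ComplexConjugate

/-! ### Parseval's identity and its restriction to a subgroup -/

section Fourier

variable {Γ H : Type*} [AddCommGroup Γ] [AddCommGroup H] [Fintype H]

/-! Upper bound (polynomial method). Each amplitude after `q` queries is, as a function of `A`, a
combination `∑ a e * e A` of characters in `queryChars 𝒜 q`: a query has spectrum in `queryChars 𝒜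
1`, composition multiplies characters, and fixed unitaries add none (`finalState_mem_spectralSpan`).
An outcome with output `k` is correct only for `A` in the fibre of `k`, which is empty or a coset of
`ker f`. On a coset, characters interfere only if they agree on `ker f`, so at most `m` at a time,
and the mean of the squared modulus there is at most `m` times the mean over `𝒜`
(`sum_filter_norm_sq_le`). Summing over outcomes, with states of norm one, gives the bound.

Attainment. Take a largest class `S` of query characters agreeing on `ker f`. Each character of `G`
has an eigenstate of the query, so a superposition of tagged eigenstates, moved from one query point
to the next by unitaries, acquires the phase `e A` on branch `e`. The last unitary sends branch `e`
to a Fourier state over the cosets of `ker f` (`cosetState`). At the coset of `A` all `|S|` branches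
then add in phase, so each oracle is identified with probability `|S| / |𝒞|`
(`exists_algorithm_of_eigenvectors`). -/

open Classical in
lemma sum_mul_conj_comp (g : H →+ Γ) (e e' : AddChar Γ ℂ) :
    ∑ h, e (g h) * conj (e' (g h)) =
      if e.compAddMonoidHom g = e'.compAddMonoidHom g then (Fintype.card H : ℂ) else 0 := by
  have h := AddChar.sum_eq_ite (e.compAddMonoidHom g - e'.compAddMonoidHom g)
  simp only [sub_eq_zero] at h
  rw [← h]
  refine Finset.sum_congr rfl fun x _ => ?_
  rw [AddChar.sub_apply, AddChar.map_neg_eq_conj]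
  rfl

open Classical in
/-- Parseval's identity for a trigonometric polynomial pulled back along a homomorphism. -/
lemma sum_norm_sq_comp (g : H →+ Γ) (S : Finset (AddChar Γ ℂ)) (a : AddChar Γ ℂ → ℂ) :
    ((∑ h, ‖∑ e ∈ S, a e * e (g h)‖ ^ 2 : ℝ) : ℂ) =
      Fintype.card H * ∑ e ∈ S, ∑ e' ∈ S,
        if e.compAddMonoidHom g = e'.compAddMonoidHom g then a e * conj (a e') else 0 := by
  have h1 : ∀ h, ((‖∑ e ∈ S, a e * e (g h)‖ ^ 2 : ℝ) : ℂ) =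
      ∑ e ∈ S, ∑ e' ∈ S, a e * conj (a e') * (e (g h) * conj (e' (g h))) := by
    intro h
    push_cast
    rw [← Complex.mul_conj', map_sum, Finset.sum_mul_sum]
    refine Finset.sum_congr rfl fun e _ => Finset.sum_congr rfl fun e' _ => ?_
    rw [map_mul]
    ring
  rw [Complex.ofReal_sum, Finset.sum_congr rfl fun h _ => h1 h, Finset.sum_comm, Finset.mul_sum]
  refine Finset.sum_congr rfl fun e _ => ?_
  rw [Finset.sum_comm, Finset.mul_sum]
  refine Finset.sum_congr rfl fun e' _ => ?_
  rw [← Finset.mul_sum, sum_mul_conj_comp]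
  split_ifs <;> ring

lemma sum_norm_sq_eq [Fintype Γ] (S : Finset (AddChar Γ ℂ)) (a : AddChar Γ ℂ → ℂ) :
    ∑ A, ‖∑ e ∈ S, a e * e A‖ ^ 2 = Fintype.card Γ * ∑ e ∈ S, ‖a e‖ ^ 2 := by
  classical
  have h := sum_norm_sq_comp (AddMonoidHom.id Γ) S a
  have hc : ∀ e : AddChar Γ ℂ, e.compAddMonoidHom (AddMonoidHom.id Γ) = e := fun e => rfl
  simp only [hc, AddMonoidHom.id_apply, Finset.sum_ite_eq] at h
  have h2 : ∑ e ∈ S, (if e ∈ S then a e * conj (a e) else 0) = ∑ e ∈ S, (‖a e‖ ^ 2 : ℂ) :=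
    Finset.sum_congr rfl fun e he => by rw [if_pos he, Complex.mul_conj']
  rw [h2] at h
  exact_mod_cast h

-- By Parseval, only pairs with equal restriction along `g` survive. Each product `‖a e‖ * ‖a e'‖`
-- is at most the mean of the two squares, and each `e` lies in at most `m` such pairs.
open Classical in
lemma sum_norm_sq_comp_le (g : H →+ Γ) (S : Finset (AddChar Γ ℂ)) (m : ℕ)
    (hm : ∀ e ∈ S, (S.filter fun e' => e.compAddMonoidHom g = e'.compAddMonoidHom g).card ≤ m)
    (a : AddChar Γ ℂ → ℂ) :
    ∑ h, ‖∑ e ∈ S, a e * e (g h)‖ ^ 2 ≤ Fintype.card H * (m * ∑ e ∈ S, ‖a e‖ ^ 2) := by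
  set R : AddChar Γ ℂ → AddChar Γ ℂ → Prop :=
    fun e e' => e.compAddMonoidHom g = e'.compAddMonoidHom g with hR
  have h1 : ∑ h, ‖∑ e ∈ S, a e * e (g h)‖ ^ 2 ≤
      Fintype.card H * ∑ e ∈ S, ∑ e' ∈ S, if R e e' then ‖a e‖ * ‖a e'‖ else 0 := by
    have h0 := congrArg norm (sum_norm_sq_comp g S a)
    rw [Complex.norm_real, Real.norm_of_nonneg (by positivity), norm_mul, Complex.norm_natCast] at h0
    rw [h0]
    gcongr
    refine (norm_sum_le _ _).trans (Finset.sum_le_sum fun e _ => ?_)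
    refine (norm_sum_le _ _).trans (Finset.sum_le_sum fun e' _ => ?_)
    simp only [hR]
    split_ifs <;> simp
  refine h1.trans ?_
  gcongr
  have h2 : ∑ e ∈ S, ∑ e' ∈ S, (if R e e' then ‖a e‖ * ‖a e'‖ else 0) ≤
      ∑ e ∈ S, ∑ e' ∈ S, ((if R e e' then ‖a e‖ ^ 2 / 2 else 0) +
        (if R e' e then ‖a e'‖ ^ 2 / 2 else 0)) := by
    refine Finset.sum_le_sum fun e _ => Finset.sum_le_sum fun e' _ => ?_
    have : R e e' ↔ R e' e := eq_comm
    by_cases h : R e e'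
    · rw [if_pos h, if_pos h, if_pos (this.1 h)]
      nlinarith [sq_nonneg (‖a e‖ - ‖a e'‖)]
    · rw [if_neg h, if_neg h, if_neg (mt this.2 h), add_zero]
  refine h2.trans ?_
  simp only [Finset.sum_add_distrib]
  rw [Finset.sum_comm (f := fun e e' => if R e' e then ‖a e'‖ ^ 2 / 2 else 0), Finset.mul_sum,
    ← Finset.sum_add_distrib]
  refine Finset.sum_le_sum fun e he => ?_
  rw [← Finset.sum_filter, Finset.sum_const, nsmul_eq_mul]
  have : ((S.filter fun e' => R e e').card : ℝ) ≤ m := by exact_mod_cast hm e he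
  nlinarith [sq_nonneg ‖a e‖]

end Fourier

/-! ### Vector-valued functions with prescribed Fourier spectrum -/

section Spectrum

variable {Γ : Type*} [AddCommGroup Γ] {V W : Type*} [AddCommGroup V] [Module ℂ V]
  [AddCommGroup W] [Module ℂ W]

/-- The `V`-valued functions on `Γ` whose Fourier spectrum is contained in `S`. -/
def spectralSpan (S : Set (AddChar Γ ℂ)) (V : Type*) [AddCommGroup V] [Module ℂ V] :
    Submodule ℂ (Γ → V) :=
  Submodule.span ℂ {ψ | ∃ e ∈ S, ∃ v : V, ψ = fun A => e A • v}

lemma smul_mem_spectralSpan {S : Set (AddChar Γ ℂ)} {e : AddChar Γ ℂ} (he : e ∈ S) (v : V) :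
    (fun A => e A • v) ∈ spectralSpan S V :=
  Submodule.subset_span ⟨e, he, v, rfl⟩

lemma fourier_inversion [Fintype Γ] (ψ : Γ → V) (A : Γ) :
    ∑ χ : AddChar Γ ℂ, χ A • ((Fintype.card Γ : ℂ)⁻¹ • ∑ B, χ (-B) • ψ B) = ψ A := by
  classical
  have h : ∀ χ : AddChar Γ ℂ, χ A • ((Fintype.card Γ : ℂ)⁻¹ • ∑ B, χ (-B) • ψ B) =
      ∑ B, ((Fintype.card Γ : ℂ)⁻¹ * χ (A - B)) • ψ B := by
    intro χ
    rw [smul_comm, Finset.smul_sum, Finset.smul_sum]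
    refine Finset.sum_congr rfl fun B _ => ?_
    rw [sub_eq_add_neg, AddChar.map_add_eq_mul, mul_smul, mul_smul]
  rw [Finset.sum_congr rfl fun χ _ => h χ, Finset.sum_comm]
  simp only [← Finset.sum_smul, ← Finset.mul_sum, AddChar.sum_apply_eq_ite, sub_eq_zero]
  simp

lemma mem_spectralSpan_of_coeff_eq_zero [Fintype Γ] {S : Set (AddChar Γ ℂ)} {ψ : Γ → V}
    (h : ∀ χ ∉ S, ∑ B, χ (-B) • ψ B = 0) : ψ ∈ spectralSpan S V := by
  have h1 : ψ = ∑ χ : AddChar Γ ℂ,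
      fun A => χ A • ((Fintype.card Γ : ℂ)⁻¹ • ∑ B, χ (-B) • ψ B) := by
    ext A
    rw [Finset.sum_apply, fourier_inversion]
  rw [h1]
  refine Submodule.sum_mem _ fun χ _ => ?_
  by_cases hχ : χ ∈ S
  · exact smul_mem_spectralSpan hχ _
  · rw [h χ hχ]
    simp only [smul_zero]
    exact Submodule.zero_mem _

lemma map_mem_spectralSpan {S : Set (AddChar Γ ℂ)} (L : V →ₗ[ℂ] W) {ψ : Γ → V}
    (hψ : ψ ∈ spectralSpan S V) : (fun A => L (ψ A)) ∈ spectralSpan S W := by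
  have : spectralSpan S V ≤ (spectralSpan S W).comap (L.compLeft Γ) := by
    refine Submodule.span_le.2 ?_
    rintro _ ⟨e, he, v, rfl⟩
    have h := smul_mem_spectralSpan he (L v)
    simp only [SetLike.mem_coe, Submodule.mem_comap]
    convert h using 1
    ext A
    simp
  exact this hψ

/-- Spectra add under composition: by linearity first in `ψ`, then in `O A v`, everything reduces to
a product of two characters. -/
lemma apply_mem_spectralSpan {S T U : Set (AddChar Γ ℂ)} (hU : ∀ e ∈ S, ∀ e' ∈ T, e + e' ∈ U)
    (O : Γ → V →ₗ[ℂ] W) (hO : ∀ v, (fun A => O A v) ∈ spectralSpan T W) {ψ : Γ → V}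
    (hψ : ψ ∈ spectralSpan S V) : (fun A => O A (ψ A)) ∈ spectralSpan U W := by
  let L : (Γ → V) →ₗ[ℂ] (Γ → W) :=
    { toFun := fun φ A => O A (φ A)
      map_add' := fun φ φ' => by ext; simp
      map_smul' := fun c φ => by ext; simp }
  have : spectralSpan S V ≤ (spectralSpan U W).comap L := by
    refine Submodule.span_le.2 ?_
    rintro _ ⟨e, he, v, rfl⟩
    let N : (Γ → W) →ₗ[ℂ] (Γ → W) :=
      { toFun := fun φ A => e A • φ A
        map_add' := fun φ φ' => by ext; simp
        map_smul' := fun c φ => by ext; exact smul_comm _ _ _ }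
    have h2 : spectralSpan T W ≤ (spectralSpan U W).comap N := by
      refine Submodule.span_le.2 ?_
      rintro _ ⟨e', he', w, rfl⟩
      have h := smul_mem_spectralSpan (hU e he e' he') w
      simp only [SetLike.mem_coe, Submodule.mem_comap]
      convert h using 1
      ext A
      simp [N, mul_smul]
    have h3 : N (fun A => O A v) ∈ spectralSpan U W := h2 (hO v)
    simp only [SetLike.mem_coe, Submodule.mem_comap]
    convert h3 using 1
    ext A
    simp only [L, N, LinearMap.coe_mk, AddHom.coe_mk, map_smul]
  exact this hψ

lemma exists_sum_of_mem_spectralSpan (S : Finset (AddChar Γ ℂ)) {ψ : Γ → ℂ}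
    (hψ : ψ ∈ spectralSpan (S : Set (AddChar Γ ℂ)) ℂ) :
    ∃ a : AddChar Γ ℂ → ℂ, ∀ A, ψ A = ∑ e ∈ S, a e * e A := by
  classical
  refine Submodule.span_induction ?_ ?_ ?_ ?_ hψ
  · rintro _ ⟨e, he, v, rfl⟩
    refine ⟨Pi.single e v, fun A => ?_⟩
    rw [Finset.sum_eq_single e]
    · simp [mul_comm]
    · intro e' _ h
      simp [h]
    · exact fun h => absurd he h
  · exact ⟨0, by simp⟩
  · rintro _ _ _ _ ⟨a, ha⟩ ⟨b, hb⟩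
    exact ⟨a + b, fun A => by simp [ha, hb, add_mul, Finset.sum_add_distrib]⟩
  · rintro c _ _ ⟨a, ha⟩
    exact ⟨c • a, fun A => by simp [ha, Finset.mul_sum, mul_assoc]⟩

end Spectrum

/-! ### The spectrum of the state after `t` queries -/

section QueryChars

variable {X G : Type*} [AddCommGroup G] {𝒜 : AddSubgroup (X → G)}

lemma zero_mem_queryChars_zero : (0 : AddChar 𝒜 ℂ) ∈ queryChars 𝒜 0 :=
  ⟨Fin.elim0, Fin.elim0, by ext A; simp [queryChar]⟩

lemma add_mem_queryChars_succ {q : ℕ} {e e' : AddChar 𝒜 ℂ} (he : e ∈ queryChars 𝒜 q)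
    (he' : e' ∈ queryChars 𝒜 1) : e + e' ∈ queryChars 𝒜 (q + 1) := by
  obtain ⟨x, ξ, rfl⟩ := he
  obtain ⟨x', ξ', rfl⟩ := he'
  refine ⟨Fin.snoc x (x' 0), Fin.snoc ξ (ξ' 0), ?_⟩
  ext A
  simp [queryChar, Fin.prod_univ_castSucc]

/-- Characters of `G` span all functions on `G`, so `A ↦ F (A x)` combines characters `A ↦ ξ (A x)`,
which are orthogonal to `χ`. Since an amplitude after one query depends on `A` only through `A x`,
this covers both query models at once. -/
lemma coeff_eq_zero_of_notMem_queryChars [Finite G] [Fintype 𝒜] {χ : AddChar 𝒜 ℂ}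
    (hχ : χ ∉ queryChars 𝒜 1) (x : X) (F : G → ℂ) :
    ∑ A : 𝒜, χ (-A) * F ((A : X → G) x) = 0 := by
  classical
  have hF : F ∈ Submodule.span ℂ (Set.range (AddChar.complexBasis G)) := by
    rw [(AddChar.complexBasis G).span_eq]
    trivial
  refine Submodule.span_induction (p := fun F _ => ∑ A : 𝒜, χ (-A) * F ((A : X → G) x) = 0)
    ?_ ?_ ?_ ?_ hF
  · rintro _ ⟨ξ, rfl⟩
    rw [AddChar.complexBasis_apply]
    have h := AddChar.sum_eq_ite (queryChar 𝒜 (fun _ : Fin 1 => x) (fun _ => ξ) - χ)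
    rw [if_neg] at h
    · rw [← h]
      refine Finset.sum_congr rfl fun A _ => ?_
      rw [AddChar.sub_apply', mul_comm, AddChar.map_neg_eq_inv]
      simp [queryChar, div_eq_mul_inv]
    · intro h0
      exact hχ ⟨_, _, (sub_eq_zero.1 h0).symm⟩
  · simp
  · intro F F' _ _ h h'
    simp [mul_add, Finset.sum_add_distrib, h, h']
  · intro c F _ h
    simp only [Pi.smul_apply, smul_eq_mul, mul_left_comm _ c, ← Finset.mul_sum, h, mul_zero]

lemma query_mem_spectralSpan [Finite G] [Fintype 𝒜] (M : QueryModel) (Z : Type*)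
    (v : Ket (X × M.Reg G × Z)) :
    (fun A : 𝒜 => query M Z (A : X → G) v) ∈ spectralSpan (queryChars 𝒜 1) (Ket (X × M.Reg G × Z)) := by
  refine mem_spectralSpan_of_coeff_eq_zero fun χ hχ => ?_
  ext ⟨x, r, z⟩
  have h := coeff_eq_zero_of_notMem_queryChars hχ x
    fun a => M.coeff a ((M.shift a).symm r) * v (x, (M.shift a).symm r, z)
  rw [lp.coeFn_sum, Finset.sum_apply]
  exact h

lemma finalState_mem_spectralSpan [Finite G] [Fintype 𝒜] (M : QueryModel) (Z : Type*) {K : Type*}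
    {t : ℕ} (Q : Algorithm (X × M.Reg G × Z) K t) :
    (fun A : 𝒜 => Q.finalState (query M Z (A : X → G))) ∈
      spectralSpan (queryChars 𝒜 t) (Ket (X × M.Reg G × Z)) := by
  obtain ⟨ψ, -, U, -⟩ := Q
  simp only [Algorithm.finalState]
  induction t with
  | zero =>
    have h := smul_mem_spectralSpan (zero_mem_queryChars_zero (𝒜 := 𝒜)) ψ
    simpa using h
  | succ t ih =>
    simp only [Fin.foldl_succ_last]
    have hadd : ∀ e ∈ queryChars 𝒜 t, ∀ e' ∈ queryChars 𝒜 1, e + e' ∈ queryChars 𝒜 (t + 1) :=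
      fun e he e' he' => add_mem_queryChars_succ he he'
    have hO : ∀ v, (fun A : 𝒜 => (query M Z (A : X → G)).toLinearEquiv.toLinearMap v) ∈
        spectralSpan (queryChars 𝒜 1) (Ket (X × M.Reg G × Z)) :=
      fun v => query_mem_spectralSpan M Z v
    have ih' := ih fun i => U i.castSucc
    have h := apply_mem_spectralSpan hadd
      (fun A : 𝒜 => (query M Z (A : X → G)).toLinearEquiv.toLinearMap) hO ih'
    have h' := map_mem_spectralSpan (U (Fin.last t)).toLinearEquiv.toLinearMap h
    exact h'

end QueryChars

lemma norm_finalState {ι K : Type*} {t : ℕ} (Q : Algorithm ι K t) (O : Ket ι ≃ₗᵢ[ℂ] Ket ι) :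
    ‖Q.finalState O‖ = 1 := by
  obtain ⟨ψ, hψ, U, -⟩ := Q
  simp only [Algorithm.finalState]
  induction t with
  | zero => simpa using hψ
  | succ t ih =>
    simp only [Fin.foldl_succ_last, LinearIsometryEquiv.norm_map]
    exact ih fun i => U i.castSucc

lemma hasSum_norm_sq {ι : Type*} (ψ : Ket ι) : HasSum (fun i => ‖ψ i‖ ^ 2) (‖ψ‖ ^ 2) := by
  have h := lp.hasSum_norm (p := 2) (by norm_num) ψ
  simpa using h

lemma outputProb_eq_tsum_indicator {ι K : Type*} {t : ℕ} (Q : Algorithm ι K t) (O : Ket ι ≃ₗᵢ[ℂ] Ket ι)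
    (k : K) : Q.outputProb O k =
      ∑' b, {b | Q.output b = k}.indicator (fun b => ‖Q.finalState O b‖ ^ 2) b :=
  tsum_subtype {b | Q.output b = k} fun b => ‖Q.finalState O b‖ ^ 2

/-! ### The upper bound -/

section UpperBound

variable {X G K : Type*} [AddCommGroup G] [AddGroup K] {𝒜 : AddSubgroup (X → G)}

open Classical in
lemma sum_filter_eq_sum_ker [Fintype 𝒜] {R : Type*} [AddCommMonoid R] (f : 𝒜 →+ K) (A₀ : 𝒜)
    (F : 𝒜 → R) :
    ∑ A with f A = f A₀, F A = ∑ β : f.ker, F (A₀ + β) := by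
  symm
  refine Finset.sum_bij (fun β _ => A₀ + (β : 𝒜)) ?_ ?_ ?_ fun _ _ => rfl
  · intro β _
    have hβ : f β = 0 := β.2
    simp [hβ]
  · intro β _ γ _ h
    exact Subtype.ext (add_left_cancel h)
  · intro A hA
    have hA' : f A = f A₀ := by simpa using hA
    exact ⟨⟨-A₀ + A, by simp [AddMonoidHom.mem_ker, hA']⟩, Finset.mem_univ _, by simp⟩

-- A nonempty fibre of `f` is a coset `A₀ + ker f`. Translating by `A₀` replaces `a e` by `a e * e
-- A₀`, of the same modulus, which reduces the estimate to `ker f`.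
open Classical in
lemma sum_filter_norm_sq_le [Fintype 𝒜] (f : 𝒜 →+ K) (k : K) {q m : ℕ}
    (hm : ∀ e ∈ queryChars 𝒜 q, (queryClass q f e).ncard ≤ m) {F : 𝒜 → ℂ}
    (hF : F ∈ spectralSpan (queryChars 𝒜 q) ℂ) :
    ∑ A with f A = k, ‖F A‖ ^ 2 ≤ (Nat.card f.ker : ℝ) / Nat.card 𝒜 * m * ∑ A, ‖F A‖ ^ 2 := by
  let S : Finset (AddChar 𝒜 ℂ) := (queryChars 𝒜 q).toFinite.toFinset
  have hS : (S : Set (AddChar 𝒜 ℂ)) = queryChars 𝒜 q := Set.Finite.coe_toFinset _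
  rw [← hS] at hF
  obtain ⟨a, ha⟩ := exists_sum_of_mem_spectralSpan S hF
  by_cases hk : ∃ A₀, f A₀ = k
  · obtain ⟨A₀, rfl⟩ := hk
    have hcard : (Nat.card 𝒜 : ℝ) ≠ 0 := by
      exact_mod_cast Nat.card_pos.ne'
    have hpars : ∑ A, ‖F A‖ ^ 2 = Nat.card 𝒜 * ∑ e ∈ S, ‖a e‖ ^ 2 := by
      rw [Nat.card_eq_fintype_card, ← sum_norm_sq_eq]
      simp only [ha]
    have hrhs : (Nat.card f.ker : ℝ) / Nat.card 𝒜 * m * ∑ A, ‖F A‖ ^ 2 =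
        Fintype.card f.ker * (m * ∑ e ∈ S, ‖a e * e A₀‖ ^ 2) := by
      rw [hpars, Nat.card_eq_fintype_card (α := f.ker)]
      simp only [norm_mul, AddChar.norm_apply, mul_one]
      field_simp
    rw [hrhs, sum_filter_eq_sum_ker f A₀]
    refine le_trans (le_of_eq ?_) (sum_norm_sq_comp_le f.ker.subtype S m ?_ _)
    · refine Finset.sum_congr rfl fun β _ => ?_
      rw [ha]
      simp only [AddChar.map_add_eq_mul, mul_assoc, AddSubgroup.coe_subtype]
    · intro e he
      have he' : e ∈ queryChars 𝒜 q := by rwa [← hS]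
      refine le_trans (le_of_eq ?_) (hm e he')
      rw [← Set.ncard_coe_finset]
      congr 1
      ext e'
      rw [Finset.coe_filter]
      simp only [Set.mem_ofPred_eq, queryClass, ← Finset.mem_coe, hS, DFunLike.ext_iff]
      refine and_congr_right fun _ => ⟨fun h B hB => (h ⟨B, hB⟩).symm, fun h B => (h B B.2).symm⟩
  · rw [Finset.filter_eq_empty_iff.2 fun A _ h => hk ⟨A, h⟩]
    simp only [Finset.sum_empty]
    positivity

/-- The upper bound on the success probability of an algorithm with `q` sequential queries. -/
theorem successProb_query_le [Finite G] [Fintype 𝒜] (f : 𝒜 →+ K) {q m : ℕ}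
    (hm : ∀ e ∈ queryChars 𝒜 q, (queryClass q f e).ncard ≤ m) (M : QueryModel) (Z : Type*)
    (Q : Algorithm (X × M.Reg G × Z) K q) :
    Q.successProb (query M Z) f ≤ (Nat.card f.ker : ℝ) / Nat.card 𝒜 * m := by
  classical
  set c := (Nat.card f.ker : ℝ) / Nat.card 𝒜 * m with hc
  have hcard : (0 : ℝ) < Fintype.card 𝒜 := by exact_mod_cast Fintype.card_pos
  let ψ : 𝒜 → Ket (X × M.Reg G × Z) := fun A => Q.finalState (query M Z (A : X → G))
  have hsum : ∀ A, HasSum (fun b => ‖ψ A b‖ ^ 2) 1 := fun A => by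
    simpa [ψ, norm_finalState] using hasSum_norm_sq (ψ A)
  have htot : HasSum (fun b => c * ∑ A, ‖ψ A b‖ ^ 2) (c * Fintype.card 𝒜) := by
    have h := (hasSum_sum (s := Finset.univ) fun A _ => hsum A).mul_left c
    simpa using h
  -- The basis may be infinite, so exchanging the sums over outcomes and oracles needs summability.
  have hind : ∀ A : 𝒜, Summable ({b | Q.output b = f A}.indicator fun b => ‖ψ A b‖ ^ 2) :=
    fun A => (hsum A).summable.indicator _
  -- The bound already holds outcome by outcome: `b` is correct exactly on the fibre of `f` over
  -- `Q.output b`.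
  have hpt : ∀ b, ∑ A : 𝒜, {b | Q.output b = f A}.indicator (fun b => ‖ψ A b‖ ^ 2) b ≤
      c * ∑ A, ‖ψ A b‖ ^ 2 := by
    intro b
    let ev : Ket (X × M.Reg G × Z) →ₗ[ℂ] ℂ :=
      { toFun := fun φ => φ b
        map_add' := fun _ _ => rfl
        map_smul' := fun _ _ => rfl }
    have hF := map_mem_spectralSpan ev (finalState_mem_spectralSpan (𝒜 := 𝒜) M Z Q)
    have h := sum_filter_norm_sq_le f (Q.output b) hm hF
    refine le_trans (le_of_eq ?_) h
    rw [Finset.sum_filter]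
    refine Finset.sum_congr rfl fun A _ => ?_
    simp only [Set.indicator_apply, Set.mem_ofPred_eq, eq_comm (a := Q.output b)]
    rfl
  rw [Algorithm.successProb, div_le_iff₀ hcard]
  calc ∑ A : 𝒜, Q.outputProb (query M Z (A : X → G)) (f A)
      = ∑ A : 𝒜, ∑' b, {b | Q.output b = f A}.indicator (fun b => ‖ψ A b‖ ^ 2) b :=
        Finset.sum_congr rfl fun A _ => outputProb_eq_tsum_indicator _ _ _
    _ = ∑' b, ∑ A : 𝒜, {b | Q.output b = f A}.indicator (fun b => ‖ψ A b‖ ^ 2) b :=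
        (Summable.tsum_finsetSum fun A _ => hind A).symm
    _ ≤ ∑' b, c * ∑ A, ‖ψ A b‖ ^ 2 :=
        Summable.tsum_le_tsum hpt (summable_sum fun A _ => hind A) htot.summable
    _ = c * Fintype.card 𝒜 := htot.tsum_eq

end UpperBound

/-! ### Unitaries and orthonormal families -/

/-- Two finite orthonormal families of the same size are related by a unitary. -/
lemma exists_unitary_map_orthonormal {V κ : Type*} [NormedAddCommGroup V] [InnerProductSpace ℂ V]
    [Finite κ] {u v : κ → V} (hu : Orthonormal ℂ u) (hv : Orthonormal ℂ v) :
    ∃ U : V ≃ₗᵢ[ℂ] V, ∀ k, U (u k) = v k := by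
  -- `V` may be infinite-dimensional. The partial isometry is extended to a unitary of the
  -- finite-dimensional span `W` of both families, and by the identity on `Wᗮ`.
  let W : Submodule ℂ V := Submodule.span ℂ (Set.range u ∪ Set.range v)
  have : FiniteDimensional ℂ W :=
    FiniteDimensional.span_of_finite ℂ ((Set.finite_range u).union (Set.finite_range v))
  have huW : ∀ k, u k ∈ W := fun k => Submodule.subset_span (Or.inl ⟨k, rfl⟩)
  have hvW : ∀ k, v k ∈ W := fun k => Submodule.subset_span (Or.inr ⟨k, rfl⟩)
  let u' : κ → W := fun k => ⟨u k, huW k⟩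
  let v' : κ → W := fun k => ⟨v k, hvW k⟩
  have hu' : Orthonormal ℂ u' := W.subtypeₗᵢ.orthonormal_comp_iff.1 hu
  have hv' : Orthonormal ℂ v' := W.subtypeₗᵢ.orthonormal_comp_iff.1 hv
  let bu := Module.Basis.span hu'.linearIndependent
  let L : Submodule.span ℂ (Set.range u') →ₗ[ℂ] W := bu.constr ℂ v'
  have hL : ∀ k, L (bu k) = v' k := fun k => bu.constr_basis ℂ v' k
  have hbu : ∀ k, ((bu k : Submodule.span ℂ (Set.range u')) : W) = u' k := fun k => by
    simp [bu, Module.Basis.span_apply]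
  have hbuo : Orthonormal ℂ bu :=
    (Submodule.subtypeₗᵢ _).orthonormal_comp_iff.1 (by
      have : (Submodule.subtypeₗᵢ (Submodule.span ℂ (Set.range u'))) ∘ bu = u' := funext hbu
      rw [this]
      exact hu')
  have hLo : Orthonormal ℂ (L ∘ bu) := by
    have : L ∘ bu = v' := funext hL
    rw [this]
    exact hv'
  let L' := L.isometryOfOrthonormal hbuo hLo
  let T : W ≃ₗᵢ[ℂ] W := L'.extend.toLinearIsometryEquiv rfl
  have hT : ∀ k, T (u' k) = v' k := fun k => by
    change L'.extend (u' k) = v' k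
    rw [← hbu k, LinearIsometry.extend_apply]
    exact hL k
  let D := W.orthogonalDecomposition
  refine ⟨(D.trans (LinearIsometryEquiv.withLpProdCongr 2 T (LinearIsometryEquiv.refl ℂ Wᗮ))).trans
    D.symm, fun k => ?_⟩
  have hD : ∀ w : W, D (w : V) = WithLp.toLp 2 (w, 0) := fun w => by
    simp [D, Submodule.orthogonalDecomposition_apply]
  simp only [LinearIsometryEquiv.trans_apply]
  rw [LinearIsometryEquiv.symm_apply_eq]
  have h1 := hD (u' k)
  have h2 := hD (v' k)
  change D (u k) = _ at h1
  change D (v k) = _ at h2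
  rw [h1, h2, ← hT k]
  rfl

section Vectors

/-- The basis vector `|i⟩`. -/
def ket {ι : Type*} (i : ι) : Ket ι := by
  classical exact lp.single 2 i 1

lemma ket_apply_self {ι : Type*} (i : ι) : ket i i = 1 := by
  simp [ket]

lemma ket_apply_of_ne {ι : Type*} {i j : ι} (h : j ≠ i) : ket i j = 0 := by
  simp [ket, h]

lemma orthonormal_ket {ι : Type*} : Orthonormal ℂ (ket : ι → Ket ι) := by
  classical
  rw [orthonormal_iff_ite]
  intro i j
  by_cases h : i = j
  · subst h
    simp [ket]
  · simp [ket, lp.inner_single_left, h]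

lemma monomial_ket {ι : Type*} (σ : ι ≃ ι) (c : ι → ℂ) (hc : ∀ i, ‖c i‖ = 1) (i : ι) :
    monomial σ c hc (ket i) = c i • ket (σ i) := by
  ext j
  change c (σ.symm j) * ket i (σ.symm j) = c i * ket (σ i) j
  by_cases h : j = σ i
  · subst h
    simp [ket_apply_self]
  · rw [ket_apply_of_ne h, ket_apply_of_ne fun h' => h (by rw [← h', Equiv.apply_symm_apply])]
    simp

lemma orthonormal_sum_smul {V κ R : Type*} [NormedAddCommGroup V] [InnerProductSpace ℂ V]
    [Fintype R] {v : κ × R → V} (hv : Orthonormal ℂ v) (c : κ → R → ℂ)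
    (hc : ∀ k, ∑ r, ‖c k r‖ ^ 2 = 1) : Orthonormal ℂ fun k => ∑ r, c k r • v (k, r) := by
  classical
  rw [orthonormal_iff_ite]
  intro k l
  simp only [sum_inner, inner_sum, inner_smul_left, inner_smul_right, orthonormal_iff_ite.1 hv,
    Prod.mk.injEq]
  by_cases h : k = l
  · subst h
    simp only [true_and, mul_ite, mul_one, mul_zero, Finset.sum_ite_eq', Finset.mem_univ, if_true]
    simp only [Complex.mul_conj']
    exact_mod_cast hc k
  · simp [h]

lemma norm_normalized_sum {V κ : Type*} [NormedAddCommGroup V] [InnerProductSpace ℂ V]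
    [Fintype κ] [Nonempty κ] {v : κ → V} (hv : Orthonormal ℂ v) :
    ‖∑ k, ((√(Fintype.card κ))⁻¹ : ℂ) • v k‖ = 1 := by
  have h : inner ℂ (∑ k, ((√(Fintype.card κ))⁻¹ : ℂ) • v k)
      (∑ k, ((√(Fintype.card κ))⁻¹ : ℂ) • v k) = 1 := by
    rw [hv.inner_sum]
    have hpos : (0 : ℝ) < Fintype.card κ := by exact_mod_cast Fintype.card_pos
    simp only [Complex.conj_mul', Finset.sum_const, Finset.card_univ, nsmul_eq_mul, norm_inv,
      Complex.norm_real, Real.norm_of_nonneg (Real.sqrt_nonneg _)]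
    rw [← Complex.ofReal_pow, inv_pow, Real.sq_sqrt hpos.le]
    have : (Fintype.card κ : ℂ) ≠ 0 := by exact_mod_cast hpos.ne'
    push_cast
    exact mul_inv_cancel₀ this
  rw [norm_eq_sqrt_re_inner (𝕜 := ℂ), h]
  simp

/-- Unitaries that carry a family of eigenvectors of `O` to the next one accumulate the
eigenvalues. -/
lemma foldl_eigenvectors {V κ : Type*} [NormedAddCommGroup V] [InnerProductSpace ℂ V] [Fintype κ]
    {t : ℕ} (O : V ≃ₗᵢ[ℂ] V) (U : Fin t → (V ≃ₗᵢ[ℂ] V)) (u : Fin (t + 1) → κ → V)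
    (hU : ∀ i k, U i (u i.castSucc k) = u i.succ k) (μ : Fin t → κ → ℂ)
    (hO : ∀ i k, O (u i.castSucc k) = μ i k • u i.castSucc k) (c : κ → ℂ) :
    Fin.foldl t (fun ψ i => U i (O ψ)) (∑ k, c k • u 0 k) =
      ∑ k, (c k * ∏ i, μ i k) • u (Fin.last t) k := by
  induction t with
  | zero => simp
  | succ t ih =>
    rw [Fin.foldl_succ_last]
    have h := ih (fun i => U i.castSucc) (fun i => u i.castSucc) (fun i k => hU i.castSucc k)
      (fun i k => μ i.castSucc k) (fun i k => hO i.castSucc k)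
    rw [Fin.castSucc_zero] at h
    rw [h]
    simp only [map_sum, map_smul, hO, hU, smul_smul, Fin.prod_univ_castSucc, Fin.succ_last, mul_assoc]

end Vectors

/-! ### Coset Fourier states and the optimal algorithm -/

section Construction

variable {X G K : Type*} [AddCommGroup G] [AddGroup K] {𝒜 : AddSubgroup (X → G)}

lemma mk_eq_mk_iff_apply_eq (f : 𝒜 →+ K) (A B : 𝒜) :
    (A : 𝒜 ⧸ f.ker) = B ↔ f A = f B := by
  rw [QuotientAddGroup.eq, AddMonoidHom.mem_ker, map_add, map_neg, neg_add_eq_zero]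

-- The product `e * conj e'` is trivial on `ker f`, hence constant on cosets, although `e` alone
-- need not be. Summing over representatives is thus character orthogonality on `𝒜` divided by `|ker
-- f|`.
open Classical in
lemma sum_out_mul_conj_eq [Fintype 𝒜] (f : 𝒜 →+ K) {e e' : AddChar 𝒜 ℂ}
    (h : ∀ B ∈ f.ker, e B = e' B) :
    ∑ c : 𝒜 ⧸ f.ker, e c.out * conj (e' c.out) =
      if e = e' then (Fintype.card (𝒜 ⧸ f.ker) : ℂ) else 0 := by
  have h1 : ∑ A, e A * conj (e' A) =
      Fintype.card f.ker * ∑ c : 𝒜 ⧸ f.ker, e c.out * conj (e' c.out) := by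
    rw [← Finset.sum_fiberwise (s := Finset.univ) (g := fun A : 𝒜 => (A : 𝒜 ⧸ f.ker)),
      Finset.mul_sum]
    refine Finset.sum_congr rfl fun c _ => ?_
    have hc : ∀ A : 𝒜, (A : 𝒜 ⧸ f.ker) = c ↔ f A = f c.out := fun A => by
      rw [← mk_eq_mk_iff_apply_eq, QuotientAddGroup.out_eq']
    simp only [hc]
    rw [sum_filter_eq_sum_ker f c.out fun A => e A * conj (e' A)]
    have hβ : ∀ β : f.ker, e (c.out + β) * conj (e' (c.out + β)) = e c.out * conj (e' c.out) := by
      intro β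
      have hn : e' (β : 𝒜) * conj (e' (β : 𝒜)) = 1 := by
        rw [Complex.mul_conj', AddChar.norm_apply]
        simp
      rw [AddChar.map_add_eq_mul, AddChar.map_add_eq_mul, h β β.2, map_mul]
      linear_combination e c.out * conj (e' c.out) * hn
    simp [hβ]
  have h2 := sum_mul_conj_comp (AddMonoidHom.id 𝒜) e e'
  have hcomp : ∀ e : AddChar 𝒜 ℂ, e.compAddMonoidHom (AddMonoidHom.id 𝒜) = e := fun e => rfl
  simp only [hcomp, AddMonoidHom.id_apply] at h2
  rw [h2] at h1
  have hk : (Fintype.card f.ker : ℂ) ≠ 0 := by exact_mod_cast Fintype.card_ne_zero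
  have hcard : (Fintype.card 𝒜 : ℂ) = Fintype.card (𝒜 ⧸ f.ker) * Fintype.card f.ker := by
    have := AddSubgroup.card_eq_card_quotient_mul_card_addSubgroup f.ker
    simp only [Nat.card_eq_fintype_card] at this
    exact_mod_cast this
  refine mul_left_cancel₀ hk ?_
  rw [← h1, hcard]
  split_ifs <;> ring

/-- The Fourier states `|𝒞|^{-1/2} ∑ c, conj (e c) |j c⟩` over the cosets `c` of `ker f`. -/
def cosetState {ι : Type*} [Fintype 𝒜] (f : 𝒜 →+ K) (j : 𝒜 ⧸ f.ker ↪ ι) (e : AddChar 𝒜 ℂ) : Ket ι :=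
  by classical exact ∑ c : 𝒜 ⧸ f.ker,
    (((√(Fintype.card (𝒜 ⧸ f.ker)) : ℝ) : ℂ)⁻¹ * conj (e c.out)) • ket (j c)

lemma orthonormal_cosetState {ι : Type*} [Fintype 𝒜] (f : 𝒜 →+ K) (j : 𝒜 ⧸ f.ker ↪ ι)
    (S : Finset (AddChar 𝒜 ℂ)) (hS : ∀ e ∈ S, ∀ e' ∈ S, ∀ B ∈ f.ker, e B = e' B) :
    Orthonormal ℂ fun e : S => cosetState f j e := by
  classical
  rw [orthonormal_iff_ite]
  intro e e'
  have hpos : (0 : ℝ) < Fintype.card (𝒜 ⧸ f.ker) := by exact_mod_cast Fintype.card_pos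
  have hsq : ((√(Fintype.card (𝒜 ⧸ f.ker)) : ℝ) : ℂ)⁻¹ * ((√(Fintype.card (𝒜 ⧸ f.ker)) : ℝ) : ℂ)⁻¹ =
      (Fintype.card (𝒜 ⧸ f.ker) : ℂ)⁻¹ := by
    rw [← mul_inv, ← Complex.ofReal_mul, Real.mul_self_sqrt hpos.le]
    simp
  have ho : Orthonormal ℂ fun c => ket (j c) := orthonormal_ket.comp j j.injective
  rw [cosetState, cosetState, ho.inner_sum]
  have hterm : ∀ c : 𝒜 ⧸ f.ker,
      conj (((√(Fintype.card (𝒜 ⧸ f.ker)) : ℝ) : ℂ)⁻¹ * conj ((e : AddChar 𝒜 ℂ) c.out)) *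
        (((√(Fintype.card (𝒜 ⧸ f.ker)) : ℝ) : ℂ)⁻¹ * conj ((e' : AddChar 𝒜 ℂ) c.out)) =
      (Fintype.card (𝒜 ⧸ f.ker) : ℂ)⁻¹ *
        ((e : AddChar 𝒜 ℂ) c.out * conj ((e' : AddChar 𝒜 ℂ) c.out)) := by
    intro c
    rw [← hsq]
    simp only [map_mul, map_inv₀, Complex.conj_ofReal, Complex.conj_conj]
    ring
  rw [Finset.sum_congr rfl fun c _ => hterm c, ← Finset.mul_sum,
    sum_out_mul_conj_eq f (hS e e.2 e' e'.2)]
  by_cases h : e = e'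
  · simp [h]
  · simp [h, Subtype.coe_injective.ne h]

lemma cosetState_apply {ι : Type*} [Fintype 𝒜] (f : 𝒜 →+ K) (j : 𝒜 ⧸ f.ker ↪ ι)
    (e : AddChar 𝒜 ℂ) (c : 𝒜 ⧸ f.ker) :
    cosetState f j e (j c) = (√(Nat.card (𝒜 ⧸ f.ker)) : ℂ)⁻¹ * conj (e c.out) := by
  classical
  rw [cosetState, lp.coeFn_sum, Finset.sum_apply, Finset.sum_eq_single c]
  · simp [ket_apply_self, Nat.card_eq_fintype_card]
  · intro c' _ h
    simp [ket_apply_of_ne (j.injective.ne h.symm)]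
  · simp

lemma cosetState_apply_of_notMem {ι : Type*} [Fintype 𝒜] (f : 𝒜 →+ K) (j : 𝒜 ⧸ f.ker ↪ ι)
    (e : AddChar 𝒜 ℂ) {b : ι} (hb : b ∉ Set.range j) : cosetState f j e b = 0 := by
  classical
  rw [cosetState, lp.coeFn_sum, Finset.sum_apply]
  refine Finset.sum_eq_zero fun c _ => ?_
  simp [ket_apply_of_ne fun h => hb ⟨c, h.symm⟩]

/-- If characters that agree on `ker f` can be written into the phases of orthonormal states, then
`f` can be computed with a success probability proportional to their number. -/
theorem exists_algorithm_of_eigenvectors {ι : Type*} [Fintype 𝒜] (f : 𝒜 →+ K) {t : ℕ}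
    (O : (X → G) → (Ket ι ≃ₗᵢ[ℂ] Ket ι)) (j : 𝒜 ⧸ f.ker ↪ ι) (S : Finset (AddChar 𝒜 ℂ))
    (hne : S.Nonempty) (hS : ∀ e ∈ S, ∀ e' ∈ S, ∀ B ∈ f.ker, e B = e' B)
    (u : Fin t → S → Ket ι) (hu : ∀ i, Orthonormal ℂ (u i)) (μ : Fin t → S → 𝒜 → ℂ)
    (hO : ∀ i e (A : 𝒜), O (A : X → G) (u i e) = μ i e A • u i e)
    (hμ : ∀ (e : S) A, ∏ i, μ i e A = (e : AddChar 𝒜 ℂ) A) :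
    ∃ Q : Algorithm ι K t, Q.successProb O f = (Nat.card f.ker : ℝ) / Nat.card 𝒜 * S.card := by
  classical
  have : Nonempty S := hne.to_subtype
  -- The coset states follow the eigenstates as the last family; for `t = 0` they are also the
  -- initial one.
  let w : Fin (t + 1) → S → Ket ι :=
    Fin.snoc (α := fun _ => S → Ket ι) u fun e => cosetState f j e
  have hw_castSucc : ∀ i : Fin t, w i.castSucc = u i := fun i => by simp [w]
  have hw_last : w (Fin.last t) = fun e : S => cosetState f j e := by simp [w]
  have hw : ∀ i, Orthonormal ℂ (w i) := fun i => by
    induction i using Fin.lastCases with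
    | last => rw [hw_last]; exact orthonormal_cosetState f j S hS
    | cast i => rw [hw_castSucc]; exact hu i
  choose U hU using fun i : Fin t => exists_unitary_map_orthonormal (hw i.castSucc) (hw i.succ)
  let Q : Algorithm ι K t :=
    { init := ∑ e, ((√(Fintype.card S))⁻¹ : ℂ) • w 0 e
      norm_init := norm_normalized_sum (hw 0)
      unitary := U
      -- The default `0` is harmless: outcomes outside the range of `j` have amplitude zero.
      output := fun b => if h : ∃ c, j c = b then f h.choose.out else 0 }
  have hout : ∀ c, Q.output (j c) = f c.out := by
    intro c
    have h : ∃ c', j c' = j c := ⟨c, rfl⟩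
    change (if h : ∃ c', j c' = j c then f h.choose.out else 0) = _
    rw [dif_pos h, j.injective h.choose_spec]
  have hfinal : ∀ A : 𝒜, Q.finalState (O (A : X → G)) =
      ∑ e : S, ((√(Fintype.card S) : ℂ)⁻¹ * (e : AddChar 𝒜 ℂ) A) • cosetState f j e := by
    intro A
    have h := foldl_eigenvectors (O (A : X → G)) U w hU (fun i e => μ i e A)
      (fun i e => by rw [hw_castSucc, hO]) fun _ => (√(Fintype.card S) : ℂ)⁻¹
    simp only [hw_last, hμ] at h
    exact h
  have hpos : (0 : ℝ) < Fintype.card S := by exact_mod_cast Fintype.card_pos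
  have hCpos : (0 : ℝ) < Nat.card (𝒜 ⧸ f.ker) := by exact_mod_cast Nat.card_pos
  have hprob : ∀ A : 𝒜, Q.outputProb (O (A : X → G)) (f A) =
      S.card / Nat.card (𝒜 ⧸ f.ker) := by
    intro A
    rw [outputProb_eq_tsum_indicator, tsum_eq_single (j (A : 𝒜 ⧸ f.ker))]
    · have hA : f (A : 𝒜 ⧸ f.ker).out = f A := by
        rw [← mk_eq_mk_iff_apply_eq, QuotientAddGroup.out_eq']
      rw [Set.indicator_of_mem (by simp only [Set.mem_ofPred_eq, hout, hA]), hfinal, lp.coeFn_sum,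
        Finset.sum_apply]
      obtain ⟨e₀, he₀⟩ := hne
      -- The phase `e A * conj (e c)`, with `c` the representative of the coset of `A`, equals `e (A
      -- - c)`. As `A - c` lies in `ker f`, it is the same for all `e` in `S`: constructive
      -- interference.
      have hterm : ∀ e : S, ((√(Fintype.card S) : ℂ)⁻¹ * (e : AddChar 𝒜 ℂ) A) *
          ((√(Nat.card (𝒜 ⧸ f.ker)) : ℂ)⁻¹ * conj ((e : AddChar 𝒜 ℂ) (A : 𝒜 ⧸ f.ker).out)) =
          (√(Fintype.card S) : ℂ)⁻¹ * (√(Nat.card (𝒜 ⧸ f.ker)) : ℂ)⁻¹ *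
            e₀ (A - (A : 𝒜 ⧸ f.ker).out) := by
        intro e
        rw [hS e₀ he₀ e e.2 _ (by rw [AddMonoidHom.mem_ker, map_sub, hA, sub_self]),
          sub_eq_add_neg, AddChar.map_add_eq_mul, AddChar.map_neg_eq_conj]
        ring
      simp only [lp.coeFn_smul, Pi.smul_apply, smul_eq_mul, cosetState_apply, hterm,
        Finset.sum_const, Finset.card_univ, nsmul_eq_mul, norm_mul, AddChar.norm_apply, mul_one,
        norm_inv, Complex.norm_real, Real.norm_of_nonneg (Real.sqrt_nonneg _), mul_pow, inv_pow,
        Real.sq_sqrt hpos.le, Real.sq_sqrt hCpos.le, Complex.norm_natCast]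
      rw [Fintype.card_coe] at hpos ⊢
      field_simp
    · intro b hb
      by_cases hbj : b ∈ Set.range j
      · obtain ⟨c, rfl⟩ := hbj
        refine Set.indicator_of_notMem (fun h => hb ?_) _
        rw [Set.mem_ofPred_eq, hout, ← mk_eq_mk_iff_apply_eq, QuotientAddGroup.out_eq'] at h
        rw [h]
      · rw [Set.indicator_apply, hfinal, lp.coeFn_sum, Finset.sum_apply]
        simp [cosetState_apply_of_notMem f j _ hbj]
  refine ⟨Q, ?_⟩
  have hcard := AddSubgroup.card_eq_card_quotient_mul_card_addSubgroup f.ker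
  have hk : (Nat.card f.ker : ℝ) ≠ 0 := by exact_mod_cast Nat.card_pos.ne'
  have hA : (Fintype.card 𝒜 : ℝ) ≠ 0 := by exact_mod_cast Fintype.card_ne_zero
  rw [Algorithm.successProb, Finset.sum_congr rfl fun A _ => hprob A, Finset.sum_const,
    Finset.card_univ, nsmul_eq_mul, mul_div_cancel_left₀ _ hA, hcard]
  push_cast
  field_simp

end Construction

/-! ### Eigenstates of a query in both models -/

namespace QueryModel

variable {G : Type*} [AddCommGroup G]

instance finite_reg [Finite G] (M : QueryModel) : Finite (M.Reg G) := by
  cases M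
  · exact inferInstanceAs (Finite (AddChar G ℂ))
  · assumption

instance nonempty_reg (M : QueryModel) : Nonempty (M.Reg G) := by
  cases M
  · exact ⟨(0 : AddChar G ℂ)⟩
  · exact ⟨(0 : G)⟩

/-- The amplitudes of the state of the response register on which a query that returns `a` acts as
multiplication by `ξ a`. -/
def eigenAmp : (M : QueryModel) → AddChar G ℂ → M.Reg G → ℂ
  | phase, ξ => fun r => by classical exact if r = ξ then 1 else 0
  | controlledAdd, ξ => fun g => (√(Nat.card G) : ℂ)⁻¹ * ξ (-g)

lemma sum_norm_sq_eigenAmp [Finite G] (M : QueryModel) [Fintype (M.Reg G)] (ξ : AddChar G ℂ) :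
    ∑ r, ‖M.eigenAmp ξ r‖ ^ 2 = 1 := by
  cases M with
  | phase =>
    rw [Finset.sum_eq_single (show Reg G phase from ξ)]
    · simp [eigenAmp]
    · intro r _ h
      simp [eigenAmp, h]
    · simp
  | controlledAdd =>
    have hpos : (0 : ℝ) < Nat.card G := by exact_mod_cast Nat.card_pos
    simp only [eigenAmp, norm_mul, norm_inv, Complex.norm_real, AddChar.norm_apply, mul_one,
      Real.norm_of_nonneg (Real.sqrt_nonneg _), inv_pow, Real.sq_sqrt hpos.le, Finset.sum_const,
      Finset.card_univ, nsmul_eq_mul, ← Nat.card_eq_fintype_card]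
    exact mul_inv_cancel₀ hpos.ne'

/-- This is the eigenvector equation read at the basis state `M.shift a r`, whose amplitude after
the query comes from `r` alone. -/
lemma coeff_mul_eigenAmp (M : QueryModel) (ξ : AddChar G ℂ) (a : G) (r : M.Reg G) :
    M.eigenAmp ξ r * M.coeff a r = ξ a * M.eigenAmp ξ (M.shift a r) := by
  cases M with
  | phase =>
    by_cases h : r = ξ
    · subst h
      simp [eigenAmp, coeff, shift]
    · simp [eigenAmp, shift, h]
  | controlledAdd =>
    change (√(Nat.card G) : ℂ)⁻¹ * ξ (-r) * 1 = ξ a * ((√(Nat.card G) : ℂ)⁻¹ * ξ (-(r + a)))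
    have h : ξ (-r) = ξ a * ξ (-(r + a)) := by
      rw [← AddChar.map_add_eq_mul]
      congr 1
      abel
    rw [h]
    ring

end QueryModel

/-! ### Optimal sequential and parallel algorithms -/

variable {X G K : Type*} [AddCommGroup G] [AddGroup K] {𝒜 : AddSubgroup (X → G)}

lemma query_sum_ket [Finite G] (M : QueryModel) [Fintype (M.Reg G)] {Z : Type*} (A : X → G) (x : X)
    (ξ : AddChar G ℂ) (z : Z) :
    query M Z A (∑ r, M.eigenAmp ξ r • ket (x, r, z)) =
      ξ (A x) • ∑ r, M.eigenAmp ξ r • ket (x, r, z) := by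
  rw [map_sum, Finset.smul_sum]
  refine Eq.trans ?_ ((M.shift (A x)).sum_comp fun r => ξ (A x) • M.eigenAmp ξ r • ket (x, r, z))
  refine Finset.sum_congr rfl fun r _ => ?_
  rw [map_smul, smul_smul, ← M.coeff_mul_eigenAmp, mul_smul, query, monomial_ket]
  rfl

lemma parallelQuery_sum_ket [Finite G] (M : QueryModel) [Fintype (M.Reg G)] {q : ℕ} {Z : Type*}
    (A : X → G) (x : Fin q → X) (ξ : Fin q → AddChar G ℂ) (z : Z) :
    parallelQuery M q Z A
        (∑ r : Fin q → M.Reg G, (∏ i, M.eigenAmp (ξ i) (r i)) • ket (fun i => (x i, r i), z)) =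
      (∏ i, ξ i (A (x i))) •
        ∑ r : Fin q → M.Reg G, (∏ i, M.eigenAmp (ξ i) (r i)) • ket (fun i => (x i, r i), z) := by
  rw [map_sum, Finset.smul_sum]
  refine Eq.trans ?_ ((Equiv.piCongrRight fun i => M.shift (A (x i))).sum_comp
    fun r : Fin q → M.Reg G => (∏ i, ξ i (A (x i))) • (∏ i, M.eigenAmp (ξ i) (r i)) •
      ket ((fun i => (x i, r i), z) : (Fin q → X × M.Reg G) × Z))
  refine Finset.sum_congr rfl fun r _ => ?_
  rw [map_smul, smul_smul, ← Finset.prod_mul_distrib, parallelQuery, monomial_ket, smul_smul,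
    ← Finset.prod_mul_distrib]
  have h : ∀ i, M.eigenAmp (ξ i) (r i) * M.coeff (A (x i)) (r i) =
      ξ i (A (x i)) * M.eigenAmp (ξ i) (M.shift (A (x i)) (r i)) :=
    fun i => M.coeff_mul_eigenAmp _ _ _
  simp only [h]
  rfl

/-- A sequential algorithm that attains `|S| / |𝒞|`. -/
theorem exists_query_algorithm [Nonempty X] [Finite G] [Fintype 𝒜] (f : 𝒜 →+ K) {q : ℕ}
    (M : QueryModel) (S : Finset (AddChar 𝒜 ℂ)) (hne : S.Nonempty)
    (hSq : ∀ e ∈ S, e ∈ queryChars 𝒜 q) (hS : ∀ e ∈ S, ∀ e' ∈ S, ∀ B ∈ f.ker, e B = e' B) :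
    ∃ (n : ℕ) (Q : Algorithm (X × M.Reg G × Fin n) K q),
      Q.successProb (query M (Fin n)) f = (Nat.card f.ker : ℝ) / Nat.card 𝒜 * S.card := by
  classical
  have := Fintype.ofFinite (M.Reg G)
  choose x ξ hxξ using fun e : S => hSq e e.2
  obtain ⟨x₀⟩ := ‹Nonempty X›
  obtain ⟨r₀⟩ := QueryModel.nonempty_reg (G := G) M
  -- The tag `j₁ e` in the workspace keeps branches orthogonal even when they make the same query at
  -- some step; `j₂` labels the cosets to be measured.
  let j₁ : S ↪ Fin (Fintype.card S + Fintype.card (𝒜 ⧸ f.ker)) :=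
    (Fintype.equivFin S).toEmbedding.trans (Fin.castAddEmb _)
  let j₂ : 𝒜 ⧸ f.ker ↪ Fin (Fintype.card S + Fintype.card (𝒜 ⧸ f.ker)) :=
    (Fintype.equivFin (𝒜 ⧸ f.ker)).toEmbedding.trans (Fin.natAddEmb _)
  refine ⟨_, exists_algorithm_of_eigenvectors f (query M _)
    ⟨fun c => (x₀, r₀, j₂ c), fun c c' h => j₂.injective (by simpa using h)⟩ S hne hS
    (fun i e => ∑ r, M.eigenAmp (ξ e i) r • ket (x e i, r, j₁ e)) (fun i => ?_)
    (fun i e A => ξ e i ((A : X → G) (x e i))) (fun i e A => query_sum_ket M _ _ _ _) ?_⟩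
  · refine orthonormal_sum_smul (v := fun p : S × M.Reg G => ket (x p.1 i, p.2, j₁ p.1))
      (orthonormal_ket.comp _ ?_) _ fun e => M.sum_norm_sq_eigenAmp _
    rintro ⟨e, r⟩ ⟨e', r'⟩ h
    simp only [Prod.mk.injEq, j₁.injective.eq_iff] at h
    exact Prod.ext h.2.2 h.2.1
  · intro e A
    conv_rhs => rw [hxξ e]
    rfl

/-- A parallel algorithm that attains `|S| / |𝒞|`. -/
theorem exists_parallelQuery_algorithm [Nonempty X] [Finite G] [Fintype 𝒜] (f : 𝒜 →+ K) {q : ℕ}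
    (M : QueryModel) (S : Finset (AddChar 𝒜 ℂ)) (hne : S.Nonempty)
    (hSq : ∀ e ∈ S, e ∈ queryChars 𝒜 q) (hS : ∀ e ∈ S, ∀ e' ∈ S, ∀ B ∈ f.ker, e B = e' B) :
    ∃ (n : ℕ) (Q : Algorithm ((Fin q → X × M.Reg G) × Fin n) K 1),
      Q.successProb (parallelQuery M q (Fin n)) f =
        (Nat.card f.ker : ℝ) / Nat.card 𝒜 * S.card := by
  classical
  have := Fintype.ofFinite (M.Reg G)
  choose x ξ hxξ using fun e : S => hSq e e.2
  obtain ⟨x₀⟩ := ‹Nonempty X›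
  obtain ⟨r₀⟩ := QueryModel.nonempty_reg (G := G) M
  let j₁ : S ↪ Fin (Fintype.card S + Fintype.card (𝒜 ⧸ f.ker)) :=
    (Fintype.equivFin S).toEmbedding.trans (Fin.castAddEmb _)
  let j₂ : 𝒜 ⧸ f.ker ↪ Fin (Fintype.card S + Fintype.card (𝒜 ⧸ f.ker)) :=
    (Fintype.equivFin (𝒜 ⧸ f.ker)).toEmbedding.trans (Fin.natAddEmb _)
  refine ⟨_, exists_algorithm_of_eigenvectors f (parallelQuery M q _)
    ⟨fun c => (fun _ => (x₀, r₀), j₂ c), fun c c' h => j₂.injective (by simpa using h)⟩ S hne hS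
    (fun _ e => ∑ r : Fin q → M.Reg G,
      (∏ i, M.eigenAmp (ξ e i) (r i)) • ket (fun i => (x e i, r i), j₁ e)) (fun _ => ?_)
    (fun _ e A => ∏ i, ξ e i ((A : X → G) (x e i)))
    (fun _ e A => parallelQuery_sum_ket M _ _ _ _) ?_⟩
  · refine orthonormal_sum_smul
      (v := fun p : S × (Fin q → M.Reg G) => ket (fun i => (x p.1 i, p.2 i), j₁ p.1))
      (orthonormal_ket.comp _ ?_) _ fun e => ?_
    · rintro ⟨e, r⟩ ⟨e', r'⟩ h
      simp only [Prod.mk.injEq, j₁.injective.eq_iff, funext_iff] at h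
      exact Prod.ext h.2 (funext fun i => (h.1 i).2)
    · simp only [norm_prod, ← Finset.prod_pow]
      -- The squared norm of a product state factors over the `q` registers.
      rw [← Fintype.prod_sum fun i r => ‖M.eigenAmp (ξ e i) r‖ ^ 2]
      simp [M.sum_norm_sq_eigenAmp]
  · intro e A
    conv_rhs => rw [hxξ e]
    simp [queryChar]

end GroupQOC

end

open GroupQOC in
/-- In each of the two query models, `m / |𝒞|` with `𝒞 = 𝒜 / ker f` and
`m = max_{e ∈ E_{𝒜,q}} |E_{𝒜,q,f,e}|` bounds the success probability of every sequential `q`-query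
algorithm, and is attained by a sequential one and also by a parallel one, with finite workspaces. -/
theorem theorem4p1 {X G K : Type*} [Nonempty X] [AddCommGroup G] [Finite G] [AddGroup K]
    (𝒜 : AddSubgroup (X → G)) [Fintype 𝒜] (f : 𝒜 →+ K) (q : ℕ) (M : QueryModel) :
    ∃ m : ℕ, IsGreatest ((fun e => (queryClass q f e).ncard) '' queryChars 𝒜 q) m ∧
      (1 / (Nat.card (𝒜 ⧸ f.ker) : ℝ)) * m = (Nat.card f.ker : ℝ) / Nat.card 𝒜 * m ∧
      (∀ (Z : Type*) (Q : Algorithm (X × M.Reg G × Z) K q),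
        Q.successProb (query M Z) f ≤ (Nat.card f.ker : ℝ) / Nat.card 𝒜 * m) ∧
      (∃ (n : ℕ) (Q : Algorithm (X × M.Reg G × Fin n) K q),
        Q.successProb (query M (Fin n)) f = (Nat.card f.ker : ℝ) / Nat.card 𝒜 * m) ∧
      (∃ (n : ℕ) (Q : Algorithm ((Fin q → X × M.Reg G) × Fin n) K 1),
        Q.successProb (parallelQuery M q (Fin n)) f =
          (Nat.card f.ker : ℝ) / Nat.card 𝒜 * m) := by
  have hne : (queryChars 𝒜 q).Nonempty :=
    ⟨_, fun _ => Classical.arbitrary X, fun _ => 0, rfl⟩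
  obtain ⟨e₀, he₀, hmax⟩ := Set.exists_max_image (queryChars 𝒜 q)
    (fun e => (queryClass q f e).ncard) (queryChars 𝒜 q).toFinite hne
  let S : Finset (AddChar 𝒜 ℂ) := (queryClass q f e₀).toFinite.toFinset
  have hmem : ∀ e, e ∈ S ↔ e ∈ queryClass q f e₀ := fun e => Set.Finite.mem_toFinset _
  have hcard : (queryClass q f e₀).ncard = S.card := Set.ncard_eq_toFinset_card _ _
  have hSne : S.Nonempty := ⟨e₀, (hmem e₀).2 ⟨he₀, fun _ _ => rfl⟩⟩
  have hSq : ∀ e ∈ S, e ∈ queryChars 𝒜 q := fun e he => ((hmem e).1 he).1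
  have hS : ∀ e ∈ S, ∀ e' ∈ S, ∀ B ∈ f.ker, e B = e' B := fun e he e' he' B hB =>
    (((hmem e).1 he).2 B hB).trans (((hmem e').1 he').2 B hB).symm
  refine ⟨(queryClass q f e₀).ncard, ⟨⟨e₀, he₀, rfl⟩, ?_⟩, ?_, fun Z Q =>
    successProb_query_le f hmax M Z Q, ?_, ?_⟩
  · rintro _ ⟨e, he, rfl⟩
    exact hmax e he
  · have hk : (Nat.card f.ker : ℝ) ≠ 0 := by exact_mod_cast Nat.card_pos.ne'
    rw [AddSubgroup.card_eq_card_quotient_mul_card_addSubgroup f.ker]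
    push_cast
    field_simp
  · rw [hcard]
    exact exists_query_algorithm f M S hSne hSq hS
  · rw [hcard]
    exact exists_parallelQuery_algorithm f M S hSne hSq hS
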